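/- Let $V$ be a Euclidean space, let $\Phi$ be an irreducible reduced crystallographic root system spanning $V$, and let $W$ be its Weyl group, that is, the group generated by the reflections $s_\alpha(x)=x-\langle x,\alpha^\vee\rangle\alpha$ for $\alpha\in\Phi$, where $\alpha^\vee=2\alpha/\langle\alpha,\alpha\rangle$. For a subring $\mathbb{Z}\subset A\subset\mathbb{R}$ let $A\Phi\subset V$ be the $A$-span of $\Phi$, viewed as a $W$-module, and let $H^1(W,A\Phi)$ be the first group cohomology of $W$ with coefficients in $A\Phi$. Let $f_\Phi$ be the index of connection of $\Phi$, that is, the (finite) index of the root lattice $\mathbb{Z}\Phi$ in the weight lattice $\{x\in V : \langle x,\alpha^\vee\rangle\in\mathbb{Z}\text{ for all }\alpha\in\Phi\}$, and let $\mathbb{Z}_{f_\Phi}:=\mathbb{Z}[1/f_\Phi]\subset\mathbb{R}$. Then $\mathbb{Z}_{f_\Phi}$ is the smallest, for inclusion, of the rings $A$ with $\mathbb{Z}\subset A\subset\mathbb{R}$ and $H^1(W,A\Phi)=0$: one has $H^1(W,\mathbb{Z}_{f_\Phi}\Phi)=0$, and $\mathbb{Z}_{f_\Phi}\subset A$ whenever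 $H^1(W,A\Phi)=0$. In particular, for every ring $A$ with $\mathbb{Z}\subset A\subset\mathbb{R}$ the following are equivalent: i) $H^1(W,A\Phi)=0$ and $A$ is minimal for inclusion among the rings between $\mathbb{Z}$ and $\mathbb{R}$ with this property; ii) $A=\mathbb{Z}_{f_\Phi}$. -/

import Mathlib

universe u

namespace RootPairing

variable {ι V N : Type*} [AddCommGroup V] [Module ℝ V] [AddCommGroup N] [Module ℝ N]

/-- The Weyl group of a crystallographic root system maps `AΦ`, the `A`-span of the roots, to
itself. -/
lemma weylGroup_smul_mem_rootSpan (P : RootPairing ι ℝ V N) (A : Subring ℝ) (w : P.weylGroup)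
    {x : V} (hx : x ∈ P.rootSpan A) : w • x ∈ P.rootSpan A := by
  induction hx using Submodule.span_induction with
  | mem x hx =>
    obtain ⟨i, rfl⟩ := hx
    rw [P.weylGroup_apply_root]
    exact Submodule.subset_span (Set.mem_range_self _)
  | zero => simp
  | add x y _ _ hx hy => rw [smul_add]; exact add_mem hx hy
  | smul a x _ hx =>
    have h : w • (a • x) = a • (w • x) := smul_comm (w : P.Aut) (a : ℝ) x
    rw [h]
    exact Submodule.smul_mem _ _ hx

/-- `AΦ` as a module over the Weyl group `W`: an abelian group on which `W` acts by restricting its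
action on `V`. The ring of scalars is `ℤ`, lifted to the universe of `W`. -/
noncomputable def rootSpanRep (P : RootPairing ι ℝ V N) (A : Subring ℝ) :
    Representation (ULift.{u} ℤ) P.weylGroup (P.rootSpan A) where
  toFun w :=
    { toFun := fun x ↦ ⟨w • (x : V), P.weylGroup_smul_mem_rootSpan A w x.2⟩
      map_add' := fun x y ↦ Subtype.ext (smul_add w (x : V) (y : V))
      map_smul' := fun n x ↦ Subtype.ext (smul_comm w n.down (x : V)) }
  map_one' := LinearMap.ext fun x ↦ Subtype.ext (one_smul _ (x : V))
  map_mul' w w' := LinearMap.ext fun x ↦ Subtype.ext (mul_smul w w' (x : V))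

/-- The weight lattice: the vectors of `V` that pair integrally with every coroot. -/
def weightLattice (P : RootPairing ι ℝ V N) : AddSubgroup V where
  carrier := {x | ∀ i, ∃ k : ℤ, P.toLinearMap x (P.coroot i) = k}
  zero_mem' := fun _ ↦ ⟨0, by simp⟩
  add_mem' := fun {x y} hx hy i ↦ by
    obtain ⟨k, hk⟩ := hx i
    obtain ⟨l, hl⟩ := hy i
    exact ⟨k + l, by simp [hk, hl]⟩
  neg_mem' := fun {x} hx i ↦ by
    obtain ⟨k, hk⟩ := hx i
    exact ⟨-k, by simp [hk]⟩

/-- The index of connection: the index of the root lattice `ℤΦ` in the weight lattice. -/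
noncomputable def indexOfConnection (P : RootPairing ι ℝ V N) : ℕ :=
  (P.rootSpan ℤ).toAddSubgroup.relIndex P.weightLattice

/-- The subring `ℤ[1/f]` of `ℝ`, where `f` is the index of connection. -/
noncomputable def connectionRing (P : RootPairing ι ℝ V N) : Subring ℝ :=
  Subring.closure {1 / (P.indexOfConnection : ℝ)}

end RootPairing

/-- `H¹(W, AΦ) = 0`, where `W` is the Weyl group of `Φ`. -/
def RootPairing.H1Vanishes {ι V N : Type u} [AddCommGroup V] [Module ℝ V] [AddCommGroup N]
    [Module ℝ N] (P : RootPairing ι ℝ V N) (A : Subring ℝ) : Prop :=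
  Subsingleton (groupCohomology.H1 (Rep.of (rootSpanRep.{u} P A)))

namespace RootPairing

/-! ### Root lattice, weight lattice and index of connection. -/

section Lattices

variable {ι V N : Type*} [AddCommGroup V] [Module ℝ V] [AddCommGroup N] [Module ℝ N]

/-! Everything reduces to: `H¹(W, AΦ) = 0` iff `1/f ∈ A`. Averaging kills `H¹(W, V)` and `V` has no
nonzero `W`-invariants, so vanishing means that every `x` with all `w • x - x ∈ AΦ` lies in `AΦ`
(`h1Vanishes_iff`). Weights are such `x`, and a weight of prime order `p` modulo `ℤΦ` forces `1/p ∈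
A`. Conversely, such an `x` is an `A`-combination of fundamental weights `ω i`, and `f • ω i ∈ ℤΦ`.
-/

/-- An element of the Weyl group is determined by its permutation of the roots. -/
lemma finite_weylGroup [Finite ι] (P : RootPairing ι ℝ V N) [P.IsRootSystem] :
    Finite P.weylGroup := by
  refine Finite.of_injective (fun w ↦ (P.weylGroupToPerm w : ι → ι)) fun w w' h ↦ ?_
  refine Subtype.ext (Equiv.weightHom_injective P (LinearEquiv.toLinearMap_injective ?_))
  refine LinearMap.ext_on_range (v := P.root) IsRootSystem.span_root_eq_top fun i ↦ ?_
  change w • P.root i = w' • P.root i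
  rw [weylGroup_apply_root, weylGroup_apply_root]
  exact congrArg P.root (congrFun h i)

lemma weylGroup_smul_comm (P : RootPairing ι ℝ V N) (w : P.weylGroup) (a : ℝ) (x : V) :
    w • (a • x) = a • (w • x) :=
  smul_comm (w : P.Aut) a x

lemma eq_zero_of_forall_toLinearMap_coroot_eq_zero (P : RootPairing ι ℝ V N) [P.IsRootSystem]
    {x : V} (h : ∀ i, P.toLinearMap x (P.coroot i) = 0) : x = 0 := by
  refine P.toPerfPair.injective ?_
  rw [map_zero]
  exact LinearMap.ext_on_range (v := P.coroot) IsRootSystem.span_coroot_eq_top h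

/-- The Weyl group of a root system has no nonzero fixed vector. -/
lemma eq_zero_of_forall_weylGroup_smul_eq (P : RootPairing ι ℝ V N) [P.IsRootSystem]
    {x : V} (h : ∀ w : P.weylGroup, w • x = x) : x = 0 := by
  refine P.eq_zero_of_forall_toLinearMap_coroot_eq_zero fun i ↦ ?_
  have hi : P.reflection i x = x := h (weylGroup.ofIdx P i)
  rw [reflection_apply, sub_eq_self] at hi
  exact (smul_eq_zero.mp hi).resolve_right (P.ne_zero i)

lemma rootSpan_int_le_weightLattice (P : RootPairing ι ℝ V N) [P.IsCrystallographic] :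
    (P.rootSpan ℤ).toAddSubgroup ≤ P.weightLattice := by
  intro x (hx : x ∈ P.rootSpan ℤ)
  induction hx using Submodule.span_induction with
  | mem x hx =>
    obtain ⟨i, rfl⟩ := hx
    intro j
    obtain ⟨k, hk⟩ := P.exists_value (S := ℤ) i j
    exact ⟨k, by simpa using hk.symm⟩
  | zero => exact zero_mem _
  | add x y hx hy ihx ihy => exact add_mem ihx ihy
  | smul a x hx ih => exact zsmul_mem ih a

lemma rootSpan_int_le_rootSpan (P : RootPairing ι ℝ V N) (A : Subring ℝ) {x : V}
    (hx : x ∈ P.rootSpan ℤ) : x ∈ P.rootSpan A :=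
  Submodule.span_subset_span ℤ A _ hx

/-- A reflection moves a weight by an integer multiple of a root, so `W` acts trivially on weights
modulo `ℤΦ`. -/
lemma weylGroup_smul_sub_mem_rootSpan_int (P : RootPairing ι ℝ V N) [P.IsCrystallographic]
    (w : P.weylGroup) {x : V} (hx : x ∈ P.weightLattice) : w • x - x ∈ P.rootSpan ℤ := by
  obtain ⟨w, hw⟩ := w
  change w • x - x ∈ P.rootSpan ℤ
  induction hw using weylGroup.induction generalizing x with
  | mem i =>
    obtain ⟨k, hk⟩ := hx i
    have : (Equiv.reflection P i) • x - x = -(k • P.root i) := by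
      rw [Equiv.reflection_smul, reflection_apply, ← Int.cast_smul_eq_zsmul ℝ, ← hk]
      simp
    rw [this]
    exact neg_mem (zsmul_mem (Submodule.subset_span (Set.mem_range_self i)) k)
  | one => simp
  | mul u v _ _ hu hv =>
    have hvx := hv hx
    have : v • x ∈ P.weightLattice := by
      simpa using add_mem (P.rootSpan_int_le_weightLattice hvx) hx
    rw [mul_smul, ← sub_add_sub_cancel _ (v • x)]
    exact add_mem (hu this) hvx

/-- The sum of all `w • x` is `W`-fixed, hence zero, so `|W| • x` is minus the sum of the
differences `w • x - x`. -/
lemma card_weylGroup_nsmul_mem_rootSpan_int [Finite ι] (P : RootPairing ι ℝ V N) [P.IsRootSystem]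
    [P.IsCrystallographic] {x : V} (hx : x ∈ P.weightLattice) :
    Nat.card P.weylGroup • x ∈ P.rootSpan ℤ := by
  have := P.finite_weylGroup
  have := Fintype.ofFinite P.weylGroup
  have h0 : ∑ w : P.weylGroup, w • x = 0 := by
    refine P.eq_zero_of_forall_weylGroup_smul_eq fun u ↦ ?_
    simp_rw [Finset.smul_sum, smul_smul]
    exact Fintype.sum_equiv (Equiv.mulLeft u) _ _ fun _ ↦ rfl
  have h1 : ∑ w : P.weylGroup, (w • x - x) ∈ P.rootSpan ℤ :=
    sum_mem fun w _ ↦ P.weylGroup_smul_sub_mem_rootSpan_int w hx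
  rw [Finset.sum_sub_distrib, h0, zero_sub, neg_mem_iff] at h1
  simpa using h1

/-- Multiplication by `|W|` embeds the weight lattice in the finitely generated `ℤΦ`; the quotient
is thus finitely generated and killed by `|W|`. -/
lemma finite_weightLattice_quotient [Finite ι] (P : RootPairing ι ℝ V N) [P.IsRootSystem]
    [P.IsCrystallographic] :
    Finite (P.weightLattice ⧸ (P.rootSpan ℤ).toAddSubgroup.addSubgroupOf P.weightLattice) := by
  have hW : Nat.card P.weylGroup ≠ 0 := by
    have := P.finite_weylGroup
    exact Nat.card_pos.ne'
  have : Module.Finite ℤ (P.rootSpan ℤ) := Module.Finite.span_of_finite ℤ (Set.finite_range P.root)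
  let f : P.weightLattice →+ P.rootSpan ℤ :=
    { toFun := fun x ↦ ⟨_, P.card_weylGroup_nsmul_mem_rootSpan_int x.2⟩
      map_zero' := Subtype.ext (smul_zero _)
      map_add' := fun x y ↦ Subtype.ext (smul_add _ _ _) }
  have hf : Function.Injective f := by
    rw [injective_iff_map_eq_zero]
    intro x hx
    have hx' : Nat.card P.weylGroup • (x : V) = 0 := congrArg Subtype.val hx
    rw [← Nat.cast_smul_eq_nsmul ℝ, smul_eq_zero, Nat.cast_eq_zero] at hx'
    exact Subtype.ext (hx'.resolve_left hW)
  have : Module.Finite ℤ P.weightLattice := Module.Finite.of_injective f.toIntLinearMap hf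
  have : Module.Finite ℤ
      (P.weightLattice ⧸ (P.rootSpan ℤ).toAddSubgroup.addSubgroupOf P.weightLattice) :=
    Module.Finite.of_surjective (QuotientAddGroup.mk' _).toIntLinearMap
      (QuotientAddGroup.mk'_surjective _)
  refine Module.finite_of_fg_torsion _ ?_
  intro y
  obtain ⟨x, rfl⟩ := QuotientAddGroup.mk_surjective y
  refine ⟨⟨(Nat.card P.weylGroup : ℤ),
    mem_nonZeroDivisors_of_ne_zero (Nat.cast_ne_zero.mpr hW)⟩, ?_⟩
  change (Nat.card P.weylGroup : ℤ) • (QuotientAddGroup.mk x :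
    P.weightLattice ⧸ (P.rootSpan ℤ).toAddSubgroup.addSubgroupOf P.weightLattice) = 0
  rw [natCast_zsmul, ← QuotientAddGroup.mk_nsmul, QuotientAddGroup.eq_zero_iff]
  exact P.card_weylGroup_nsmul_mem_rootSpan_int x.2

lemma indexOfConnection_pos [Finite ι] (P : RootPairing ι ℝ V N) [P.IsRootSystem]
    [P.IsCrystallographic] : 0 < P.indexOfConnection := by
  have := P.finite_weightLattice_quotient
  exact Nat.card_pos

lemma indexOfConnection_nsmul_mem_rootSpan_int (P : RootPairing ι ℝ V N) {x : V}
    (hx : x ∈ P.weightLattice) : P.indexOfConnection • x ∈ P.rootSpan ℤ :=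
  AddSubgroup.nsmul_relIndex_mem (P.rootSpan ℤ).toAddSubgroup hx

/-- A vector lies in the `S`-span of the roots if and only if its coordinates with respect to the
simple roots lie in `S`. -/
lemma Base.mem_rootSpan_iff {P : RootPairing ι ℝ V N} [P.IsRootSystem] (b : P.Base)
    (S : Type*) [CommRing S] [IsDomain S] [Algebra S ℝ] [Module.IsTorsionFree S ℝ] [Module S V]
    [IsScalarTower S ℝ V]
    {x : V} :
    x ∈ P.rootSpan S ↔ ∀ i, b.toWeightBasis.repr x i ∈ Set.range (algebraMap S ℝ) := by
  have h : P.rootSpan S = Submodule.span S (Set.range b.toWeightBasis) := by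
    have hr : Set.range b.toWeightBasis = P.root '' b.support := by
      ext v
      simp
    rw [hr]
    refine le_antisymm (Submodule.span_le.mpr ?_) (Submodule.span_mono (Set.image_subset_range _ _))
    rintro - ⟨i, rfl⟩
    exact Submodule.span_subset_span ℤ S _ (b.root_mem_span_int i)
  rw [h, Module.Basis.mem_span_iff_repr_mem]

/-- If the weight lattice is contained in `AΦ`, then each prime dividing the index of connection is
invertible in `A`. -/
lemma one_div_prime_mem_of_weightLattice_le [Finite ι] (P : RootPairing ι ℝ V N) [P.IsRootSystem]
    [P.IsCrystallographic] [P.IsReduced] (A : Subring ℝ)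
    (h : ∀ x ∈ P.weightLattice, x ∈ P.rootSpan A) {p : ℕ} (hp : p.Prime)
    (hpf : p ∣ P.indexOfConnection) : 1 / (p : ℝ) ∈ A := by
  obtain ⟨b⟩ := P.nonempty_base
  have := P.finite_weightLattice_quotient
  have := Fintype.ofFinite
    (P.weightLattice ⧸ (P.rootSpan ℤ).toAddSubgroup.addSubgroupOf P.weightLattice)
  have := Fact.mk hp
  -- Cauchy's theorem in the finite quotient of weights by roots.
  obtain ⟨y, hy⟩ := exists_prime_addOrderOf_dvd_card
    (G := P.weightLattice ⧸ (P.rootSpan ℤ).toAddSubgroup.addSubgroupOf P.weightLattice) p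
    (by rw [← Nat.card_eq_fintype_card]; exact hpf)
  obtain ⟨⟨x, hxP⟩, rfl⟩ := QuotientAddGroup.mk_surjective y
  have hpx : p • x ∈ P.rootSpan ℤ := by
    have := addOrderOf_nsmul_eq_zero (QuotientAddGroup.mk (⟨x, hxP⟩ : P.weightLattice) :
      P.weightLattice ⧸ (P.rootSpan ℤ).toAddSubgroup.addSubgroupOf P.weightLattice)
    rw [hy, ← QuotientAddGroup.mk_nsmul, QuotientAddGroup.eq_zero_iff] at this
    exact this
  have hx : x ∉ P.rootSpan ℤ := by
    intro hx
    have : (QuotientAddGroup.mk (⟨x, hxP⟩ : P.weightLattice) :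
        P.weightLattice ⧸ (P.rootSpan ℤ).toAddSubgroup.addSubgroupOf P.weightLattice) = 0 := by
      rw [QuotientAddGroup.eq_zero_iff]
      exact hx
    rw [this, addOrderOf_zero] at hy
    exact hp.one_lt.ne hy
  rw [b.mem_rootSpan_iff ℤ, not_forall] at hx
  obtain ⟨i, hi⟩ := hx
  obtain ⟨n, hn⟩ := (b.mem_rootSpan_iff ℤ).mp hpx i
  obtain ⟨a, ha⟩ := (b.mem_rootSpan_iff A).mp (h x hxP) i
  have hp0 : (p : ℝ) ≠ 0 := Nat.cast_ne_zero.mpr hp.ne_zero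
  replace hn : (n : ℝ) = p * b.toWeightBasis.repr x i := by
    simpa using hn
  have hnp : ¬ (p : ℤ) ∣ n := by
    rintro ⟨m, rfl⟩
    refine hi ⟨m, ?_⟩
    push_cast at hn
    exact mul_left_cancel₀ hp0 hn
  -- Some coordinate of `x` is `n / p` with `p ∤ n`, and it lies in `A`; Bézout then yields `1 / p`.
  obtain ⟨u, v, huv⟩ := (Nat.prime_iff_prime_int.mp hp).coprime_iff_not_dvd.mpr hnp
  have huv' : (u : ℝ) * p + v * n = 1 := by exact_mod_cast huv
  have key : 1 / (p : ℝ) = u + v * a := by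
    change _ = (u : ℝ) + v * algebraMap A ℝ a
    rw [ha, div_eq_iff hp0, ← huv', hn]
    ring
  rw [key]
  exact add_mem (intCast_mem A u) (mul_mem (intCast_mem A v) a.2)

lemma one_div_natCast_mem_of_forall_prime (A : Subring ℝ) (n : ℕ)
    (h : ∀ p : ℕ, p.Prime → p ∣ n → 1 / (p : ℝ) ∈ A) : 1 / (n : ℝ) ∈ A := by
  induction n using induction_on_primes with
  | zero => simp
  | one => simp
  | prime_mul p a hp ih =>
    rw [Nat.cast_mul, ← one_div_mul_one_div]
    exact mul_mem (h p hp (dvd_mul_right p a)) (ih fun q hq hqa ↦ h q hq (hqa.mul_left p))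

/-- If `f` is invertible in `A`, then every vector which is moved by the Weyl group only by elements
of `AΦ` lies in `AΦ`. -/
lemma mem_rootSpan_of_forall_weylGroup_smul_sub_mem [Finite ι] (P : RootPairing ι ℝ V N)
    [P.IsRootSystem] [P.IsCrystallographic] [P.IsReduced] {A : Subring ℝ}
    (hA : 1 / (P.indexOfConnection : ℝ) ∈ A) {x : V}
    (hx : ∀ w : P.weylGroup, w • x - x ∈ P.rootSpan A) : x ∈ P.rootSpan A := by
  obtain ⟨b⟩ := P.nonempty_base
  have hpair (i : b.support) : P.toLinearMap x (P.coroot i) ∈ A := by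
    obtain ⟨a, ha⟩ := (b.mem_rootSpan_iff A).mp (hx (weylGroup.ofIdx P i)) i
    have : weylGroup.ofIdx P i • x - x = -(P.toLinearMap x (P.coroot i) • P.root i) := by
      rw [weylGroup.ofIdx_smul, Equiv.reflection_smul, reflection_apply]
      simp
    rw [this, map_neg, map_smul, b.toWeightBasis_repr_root] at ha
    rw [← neg_mem_iff]
    have ha' : (a : ℝ) = -P.toLinearMap x (P.coroot i) := by simpa using! ha
    exact ha' ▸ a.2
  -- The fundamental weights, dual to the simple coroots.
  let ω (i : b.support) : V := P.toPerfPair.symm (b.toCoweightBasis.coord i)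
  have hω (i : b.support) (y : N) : P.toLinearMap (ω i) y = b.toCoweightBasis.repr y i :=
    LinearMap.congr_fun (P.toPerfPair.apply_symm_apply (b.toCoweightBasis.coord i)) y
  have hωP (i : b.support) : ω i ∈ P.weightLattice := by
    intro j
    obtain ⟨k, hk⟩ := (b.flip.mem_rootSpan_iff (P := P.flip) ℤ).mp
      (Submodule.subset_span (Set.mem_range_self j)) i
    exact ⟨k, (hω i _).trans hk.symm⟩
  have hsum : x = ∑ i : b.support, P.toLinearMap x (P.coroot i) • ω i := by
    refine P.toPerfPair.injective (b.toCoweightBasis.ext fun j ↦ ?_)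
    change P.toLinearMap x _ = P.toLinearMap _ _
    have hj (i : b.support) (hij : i ≠ j) : (Finsupp.single j (1 : ℝ)) i = 0 :=
      Finsupp.single_eq_of_ne hij
    rw [map_sum, LinearMap.sum_apply, Finset.sum_eq_single j (fun i _ hij ↦ ?_) (by simp)]
    · simp [hω]
    · simp [hω, hj i hij]
  have hωA (i : b.support) : ω i ∈ P.rootSpan A := by
    have h := P.rootSpan_int_le_rootSpan A (P.indexOfConnection_nsmul_mem_rootSpan_int (hωP i))
    have h' := Submodule.smul_mem _ (⟨_, hA⟩ : A) h
    have hf : (P.indexOfConnection : ℝ) ≠ 0 := Nat.cast_ne_zero.mpr P.indexOfConnection_pos.ne'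
    change (1 / (P.indexOfConnection : ℝ)) • (P.indexOfConnection • ω i) ∈ P.rootSpan A at h'
    rwa [← Nat.cast_smul_eq_nsmul ℝ, smul_smul, one_div_mul_cancel hf, one_smul] at h'
  rw [hsum]
  exact sum_mem fun i _ ↦ Submodule.smul_mem _ (⟨_, hpair i⟩ : A) (hωA i)

end Lattices

/-! ### First cohomology of the Weyl group. -/

section Cohomology

open groupCohomology

variable {ι V N : Type u} [AddCommGroup V] [Module ℝ V] [AddCommGroup N] [Module ℝ N]

/-- Since `H¹(W, V) = 0` and `V` has no nonzero fixed vector, `H¹(W, AΦ)` is the quotient by `AΦ` of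
the group of vectors which are moved by `W` only by elements of `AΦ`. -/
lemma h1Vanishes_iff [Finite ι] (P : RootPairing ι ℝ V N) [P.IsRootSystem] (A : Subring ℝ) :
    P.H1Vanishes A ↔
      ∀ x : V, (∀ w : P.weylGroup, w • x - x ∈ P.rootSpan A) → x ∈ P.rootSpan A := by
  have := P.finite_weylGroup
  have := Fintype.ofFinite P.weylGroup
  constructor
  · intro h x hx
    -- The coboundary of `x` in `V`, a cocycle with values in `AΦ`.
    let c : P.weylGroup → Rep.of (rootSpanRep.{u} P A) := fun w ↦ (⟨_, hx w⟩ : P.rootSpan A)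
    have hc : c ∈ cocycles₁ (Rep.of (rootSpanRep.{u} P A)) := by
      rw [mem_cocycles₁_iff]
      intro g k
      refine Subtype.ext ?_
      change (g * k) • x - x = g • (k • x - x) + (g • x - x)
      rw [smul_sub, mul_smul]
      abel
    have h0 : H1π (Rep.of (rootSpanRep.{u} P A)) ⟨c, hc⟩ = 0 := h.elim _ _
    rw [H1π_eq_zero_iff] at h0
    obtain ⟨y, hy⟩ := h0
    have hxy : x - (show P.rootSpan A from y : V) = 0 := by
      refine P.eq_zero_of_forall_weylGroup_smul_eq fun w ↦ ?_
      have hw : w • (show P.rootSpan A from y : V) - (show P.rootSpan A from y : V) = w • x - x :=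
        congrArg (fun z : P.rootSpan A ↦ (z : V)) (congrFun hy w)
      rw [smul_sub, sub_eq_sub_iff_sub_eq_sub, hw]
    rw [sub_eq_zero.mp hxy]
    exact (show P.rootSpan A from y).2
  · intro h
    refine subsingleton_of_forall_eq 0 fun z ↦ ?_
    induction z using H1_induction_on with | h c =>
    rw [H1π_eq_zero_iff]
    let c' : P.weylGroup → V := fun w ↦ (show P.rootSpan A from c w : V)
    have hc (g k : P.weylGroup) : c' (g * k) = g • c' k + c' g :=
      congrArg (fun z : P.rootSpan A ↦ (z : V)) ((mem_cocycles₁_iff _).mp c.2 g k)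
    let n : ℝ := Fintype.card P.weylGroup
    have hn : n ≠ 0 := Nat.cast_ne_zero.mpr Fintype.card_ne_zero
    -- Minus the average of the cocycle: summing the cocycle identity over `W` shows that its
    -- coboundary is `c'`.
    let x : V := -(n⁻¹ • ∑ w, c' w)
    have hx (g : P.weylGroup) : g • x - x = c' g := by
      have hS : ∑ w, c' w = g • (∑ w, c' w) + n • c' g := by
        calc ∑ w, c' w = ∑ w, c' (g * w) :=
              (Fintype.sum_equiv (Equiv.mulLeft g) _ _ fun _ ↦ rfl).symm
          _ = _ := by
              simp_rw [hc, Finset.sum_add_distrib, Finset.smul_sum]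
              simp [n, Nat.cast_smul_eq_nsmul]
      have : n⁻¹ • ∑ w, c' w = n⁻¹ • (g • ∑ w, c' w) + c' g := by
        conv_lhs => rw [hS, smul_add, smul_smul, inv_mul_cancel₀ hn, one_smul]
      rw [smul_neg, weylGroup_smul_comm, neg_sub_neg, this]
      abel
    have hxA : x ∈ P.rootSpan A := h x fun w ↦ by
      rw [hx]
      exact (show P.rootSpan A from c w).2
    exact ⟨(⟨x, hxA⟩ : P.rootSpan A), funext fun w ↦ Subtype.ext (hx w)⟩

lemma h1Vanishes_iff_one_div_indexOfConnection_mem [Finite ι] (P : RootPairing ι ℝ V N)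
    [P.IsRootSystem] [P.IsCrystallographic] [P.IsReduced] (A : Subring ℝ) :
    P.H1Vanishes A ↔ 1 / (P.indexOfConnection : ℝ) ∈ A := by
  rw [h1Vanishes_iff]
  refine ⟨fun h ↦ one_div_natCast_mem_of_forall_prime A _ fun p hp hpf ↦
    P.one_div_prime_mem_of_weightLattice_le A (fun x hx ↦ h x fun w ↦ ?_) hp hpf,
    fun h x hx ↦ P.mem_rootSpan_of_forall_weylGroup_smul_sub_mem h hx⟩
  exact P.rootSpan_int_le_rootSpan A (P.weylGroup_smul_sub_mem_rootSpan_int w hx)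

end Cohomology

end RootPairing

theorem mainTheorem4 {ι V N : Type u} [Finite ι] [AddCommGroup V] [Module ℝ V]
    [AddCommGroup N] [Module ℝ N] (P : RootPairing ι ℝ V N) [P.IsRootSystem]
    [P.IsCrystallographic] [P.IsReduced] [P.IsIrreducible] :
    0 < P.indexOfConnection ∧
    IsLeast {A : Subring ℝ | P.H1Vanishes A} P.connectionRing ∧
    ∀ A : Subring ℝ, Minimal P.H1Vanishes A ↔ A = P.connectionRing := by
  have hleast : IsLeast {A : Subring ℝ | P.H1Vanishes A} P.connectionRing := by
    constructor
    · exact (P.h1Vanishes_iff_one_div_indexOfConnection_mem _).mpr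
        (Subring.subset_closure (Set.mem_singleton _))
    · intro A hA
      exact Subring.closure_le.mpr (Set.singleton_subset_iff.mpr
        ((P.h1Vanishes_iff_one_div_indexOfConnection_mem A).mp hA))
  refine ⟨P.indexOfConnection_pos, hleast, fun A ↦ ?_⟩
  exact hleast.minimal_iff
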